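/- Let $G$ be a finitely generated group. Choose a path connected CW complex $X$ with finite $1$-skeleton and $\pi_1(X)\cong G$, and let $Y=\widetilde X^1$ be the $1$-skeleton of its universal cover, on which $G$ acts by deck transformations. (Equivalently, $Y$ is any connected graph, loops and multiple edges allowed, on which $G$ acts by automorphisms, freely on vertices and on edges, with finitely many orbits of vertices and of edges; for instance a Cayley graph of $G$ with respect to a finite generating set.) For a subgroup $L\le G$ let $p_L:Y\to L\backslash Y$ be the quotient covering map, and choose a finite filtration $C_0\subseteq C_1\subseteq\cdots$ of $L\backslash Y$, i.e. an increasing sequence of finite subgraphs with union $L\backslash Y$. The number of filtered ends of the pair $(G,L)$ (in the sense of Kropholler and Roller) is $$e(G,L)=\Big|\varprojlim_n \pi_0\big(Y\overset{c}{-}p_L^{-1}(C_n)\big)\Big|\in\{0,1,2,\dots\}\cup\{\infty\},$$ where $Y\overset{c}{-}A$ denotes the full subgraph of $Y$ spanned by the vertices that are not in $A$. Let $K\le H<G$ be subgroups and suppose that $e(G,H)=n$ is finite and nonzero. Then $$e(G,K)=\begin{cases} n & \text{if } [H:K]<\infty,\\ 1 & \text{if } [H:K]=\infty.\end{cases}$$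 Here $e(G,H)$ and $e(G,K)$ may be computed from any choices of $X$ and of the finite filtrations, independently of each other. -/

import Mathlib

namespace FilteredEnds

/-- A graph, i.e. a 1-dimensional CW complex: a set `V` of vertices, a set `E` of edges, and
for every edge the unordered pair of its end points. Loops and multiple edges are allowed. -/
structure CWGraph (V E : Type*) where
  ends : E → Sym2 V

namespace CWGraph

variable {V E : Type*}

/-- The underlying simple graph: two distinct vertices are adjacent if an edge joins them.
It has the same connected components as the 1-dimensional complex, and so does every full
subgraph. -/
def toSimpleGraph (Y : CWGraph V E) : SimpleGraph V where
  Adj v w := v ≠ w ∧ ∃ e, Y.ends e = s(v, w)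
  symm := ⟨fun _ _ h => ⟨h.1.symm, h.2.imp fun _ he => he.trans Sym2.eq_swap⟩⟩
  loopless := ⟨fun _ h => h.1 rfl⟩

/-- A subcomplex: a set of cells which contains the end points of each of its edges. -/
@[ext]
structure Subcomplex (Y : CWGraph V E) where
  verts : Set V
  edges : Set E
  ends_mem : ∀ e ∈ edges, ∀ v ∈ Y.ends e, v ∈ verts

/-- A filtration of a graph: an increasing sequence of subcomplexes whose union is everything. -/
structure Filtration (Y : CWGraph V E) where
  sub : ℕ → Y.Subcomplex
  verts_mono : ∀ ⦃m n⦄, m ≤ n → (sub m).verts ⊆ (sub n).verts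
  edges_mono : ∀ ⦃m n⦄, m ≤ n → (sub m).edges ⊆ (sub n).edges
  exists_mem_verts : ∀ v, ∃ n, v ∈ (sub n).verts
  exists_mem_edges : ∀ e, ∃ n, e ∈ (sub n).edges

/-- A finite filtration: every member of the filtration is a finite subcomplex. -/
def Filtration.IsFinite {Y : CWGraph V E} (L : Y.Filtration) : Prop :=
  ∀ n, (L.sub n).verts.Finite ∧ (L.sub n).edges.Finite

/-- `π₀` of the CW complement of a subcomplex `A`. The CW complement is the largest
subcomplex whose vertices are those not in `A`, that is the full subgraph
spanned by these vertices. -/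
abbrev PiZeroCompl (Y : CWGraph V E) (A : Y.Subcomplex) : Type _ :=
  Y.toSimpleGraph.ComponentCompl A.verts

/-- The inverse limit of the sets `π₀` of the CW complements of the members of a filtration,
with the maps induced by inclusion. -/
def EndLimit (Y : CWGraph V E) (L : Y.Filtration) : Type _ :=
  {s : ∀ n, Y.PiZeroCompl (L.sub n) //
    ∀ (m n : ℕ) (h : m ≤ n), (s n).hom (L.verts_mono h) = s m}

/-- The number of filtered ends of a graph with respect to a filtration (`⊤` if infinite). -/
noncomputable def numFilteredEnds (Y : CWGraph V E) (L : Y.Filtration) : ℕ∞ :=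
  ENat.card (Y.EndLimit L)

end CWGraph

/-- A graph with an action of `G` by graph automorphisms. -/
structure GGraph (G : Type*) [Group G] (V E : Type*) [MulAction G V] [MulAction G E]
    extends CWGraph V E where
  ends_smul : ∀ (g : G) (e : E), ends (g • e) = (ends e).map (fun v => g • v)

namespace GGraph

variable {G : Type*} [Group G] {V E : Type*} [MulAction G V] [MulAction G E]

/-- `Y` is the 1-skeleton of the universal cover of a path connected CW complex `X` with finite
1-skeleton and fundamental group `G`, with `G` acting by deck transformations. Such 1-skeleta
are precisely the connected graphs on which `G` acts freely (on vertices and on edges, so that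
no edge is inverted) with finitely many orbits of cells: given such a graph `Y`, one obtains `X`
from the finite graph `G \ Y` by attaching a 2-cell along every closed edge path that lifts to a
closed edge path in `Y`. If `X` is the complex of a presentation, `Y` is a Cayley graph of `G`. -/
structure IsUniversalCoverSkeleton (Y : GGraph G V E) : Prop where
  connected : Y.toSimpleGraph.Connected
  free_verts : ∀ (g : G) (v : V), g • v = v → g = 1
  free_edges : ∀ (g : G) (e : E), g • e = e → g = 1
  finite_verts : Finite (MulAction.orbitRel.Quotient G V)
  finite_edges : Finite (MulAction.orbitRel.Quotient G E)

/-- The quotient graph `H \ Y`; for the 1-skeleton `Y` of a universal cover this is the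
1-skeleton of the covering space corresponding to `H`. -/
def quotient (Y : GGraph G V E) (H : Subgroup G) :
    CWGraph (MulAction.orbitRel.Quotient H V) (MulAction.orbitRel.Quotient H E) where
  ends := Quotient.lift
    (fun e => (Y.ends e).map (fun v => (Quotient.mk _ v : MulAction.orbitRel.Quotient H V))) (by
      rintro _ e ⟨h, rfl⟩
      change Sym2.map _ (Y.ends ((h : G) • e)) = _
      rw [Y.ends_smul, Sym2.map_map]
      congr 1
      funext v
      exact Quotient.sound ⟨h, rfl⟩)

/-- The preimage of a subcomplex of `H \ Y` under the covering projection `p : Y → H \ Y`. -/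
def preimage (Y : GGraph G V E) (H : Subgroup G) (C : (Y.quotient H).Subcomplex) :
    Y.toCWGraph.Subcomplex where
  verts := {v | (Quotient.mk _ v : MulAction.orbitRel.Quotient H V) ∈ C.verts}
  edges := {e | (Quotient.mk _ e : MulAction.orbitRel.Quotient H E) ∈ C.edges}
  ends_mem _ he v hv := C.ends_mem _ he _ (Sym2.mem_map.2 ⟨v, hv, rfl⟩)

/-- The filtration `p⁻¹(C₀) ⊆ p⁻¹(C₁) ⊆ …` of `Y` obtained from a filtration of `H \ Y`. -/
def pullback (Y : GGraph G V E) (H : Subgroup G) (C : (Y.quotient H).Filtration) :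
    Y.toCWGraph.Filtration where
  sub n := Y.preimage H (C.sub n)
  verts_mono _ _ h _ hv := C.verts_mono h hv
  edges_mono _ _ h _ he := C.edges_mono h he
  exists_mem_verts _ := C.exists_mem_verts _
  exists_mem_edges _ := C.exists_mem_edges _

/-- The number of filtered ends of the pair `(G, H)`, computed from the 1-skeleton `Y` of a
universal cover and a filtration `C` of the quotient graph `H \ Y` (by finite subcomplexes). -/
noncomputable def filteredEnds (Y : GGraph G V E) (H : Subgroup G)
    (C : (Y.quotient H).Filtration) : ℕ∞ :=
  Y.toCWGraph.numFilteredEnds (Y.pullback H C)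

end GGraph

end FilteredEnds

/-! Call a vertex set almost invariant if its outer boundary lies in finitely many orbits. Then e(G,
L) is the largest size of a family of disjoint almost invariant sets that are not `L`-small
(`le_filteredEnds_iff`). Such families pull back along equivariant maps (`IsEndFamily.comap`), so
the choice of graph and filtration is irrelevant. If [H:K] is finite, `K`-small and `H`-small agree,
and so do the two numbers.

For the other case, suppose e(G, K) ≥ 2. This gives a `K`-almost invariant `B` with neither `B` nor
its complement `K`-small, hence neither `H`-small (`small_of_small`). As e(G, H) = n is finite, the
translates of `B` by `H` fall into at most 2^n classes modulo `H`-small sets. Within a class,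
differences of translates lie in one `H`-small set `Q` (`exists_small_bound`). For suitable points
`a`, `b` off `Q`, every `h` of the class has `h • a ∈ B` and `h • b ∉ B`, and such `h` form a
`K`-small set (`small_crossing`). So `H` is a finite union of `K`-small sets and [H:K] is finite.
Finally e(G, K) ≥ 1, since n ≠ 0 prevents the vertex set from being small. -/

namespace FilteredEnds

/-! ### Smallness relative to a subgroup -/

section Small

variable {G : Type*} [Group G] {X : Type*} [MulAction G X]

/-- A set is small relative to a subgroup `K` if it is contained in finitely many `K`-orbits. -/
def Small (K : Subgroup G) (S : Set X) : Prop :=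
  ∃ F : Set X, F.Finite ∧ ∀ v ∈ S, ∃ k ∈ K, k • v ∈ F

variable {K H : Subgroup G} {S T : Set X}

theorem Small.mono (hT : Small K T) (h : S ⊆ T) : Small K S := by
  obtain ⟨F, hF, hF'⟩ := hT
  exact ⟨F, hF, fun v hv => hF' v (h hv)⟩

theorem Small.of_le (hS : Small K S) (h : K ≤ H) : Small H S := by
  obtain ⟨F, hF, hF'⟩ := hS
  refine ⟨F, hF, fun v hv => ?_⟩
  obtain ⟨k, hk, hkv⟩ := hF' v hv
  exact ⟨k, h hk, hkv⟩

theorem small_of_finite (hS : S.Finite) : Small K S :=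
  ⟨S, hS, fun v hv => ⟨1, K.one_mem, by simpa using hv⟩⟩

theorem Small.biUnion {ι : Type*} {I : Set ι} (hI : I.Finite) {S : ι → Set X}
    (hS : ∀ i ∈ I, Small K (S i)) : Small K {v | ∃ i ∈ I, v ∈ S i} := by
  choose! F hF hF' using hS
  refine ⟨⋃ i ∈ I, F i, hI.biUnion hF, ?_⟩
  rintro v ⟨i, hi, hv⟩
  obtain ⟨k, hk, hkv⟩ := hF' i hi v hv
  exact ⟨k, hk, Set.mem_biUnion hi hkv⟩

theorem Small.union (hS : Small K S) (hT : Small K T) : Small K (S ∪ T) := by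
  obtain ⟨F, hF, hF'⟩ := hS
  obtain ⟨F₂, hF₂, hF₂'⟩ := hT
  refine ⟨F ∪ F₂, hF.union hF₂, ?_⟩
  rintro v (hv | hv)
  · obtain ⟨k, hk, hkv⟩ := hF' v hv
    exact ⟨k, hk, Or.inl hkv⟩
  · obtain ⟨k, hk, hkv⟩ := hF₂' v hv
    exact ⟨k, hk, Or.inr hkv⟩

/-- The union of all translates of a small set is small. -/
theorem Small.saturate (hS : Small K S) : Small K {v | ∃ k ∈ K, k • v ∈ S} := by
  obtain ⟨F, hF, hF'⟩ := hS
  refine ⟨F, hF, ?_⟩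
  rintro v ⟨k, hk, hkv⟩
  obtain ⟨l, hl, hlv⟩ := hF' _ hkv
  exact ⟨l * k, K.mul_mem hl hk, by rwa [mul_smul]⟩

theorem Small.smul_mem (hS : Small K S) {k : G} (hk : k ∈ K) : Small K {v | k • v ∈ S} :=
  hS.saturate.mono fun _ hv => ⟨k, hk, hv⟩

/-- Freeness makes `g ↦ g • p` injective, so smallness passes from `X` to `G` under left
multiplication. -/
theorem Small.orbit_preimage (free : ∀ (g : G) (v : X), g • v = v → g = 1) (hS : Small K S)
    (p : X) : Small K {g : G | g • p ∈ S} := by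
  obtain ⟨F, hF, hF'⟩ := hS
  refine ⟨{g | g • p ∈ F}, hF.preimage ?_, ?_⟩
  · intro a _ b _ hab
    have : b⁻¹ • a • p = p := by
      have hab : a • p = b • p := hab
      rw [hab, inv_smul_smul]
    rw [smul_smul] at this
    exact (inv_mul_eq_one.1 (free _ _ this)).symm
  · intro g hg
    obtain ⟨k, hk, hkv⟩ := hF' _ hg
    exact ⟨k, hk, by simpa [mul_smul] using hkv⟩

theorem Small.orbit_image {T : Set G} (hT : Small K T) (b : X) :
    Small K {v : X | ∃ t ∈ T, t • b = v} := by
  obtain ⟨F, hF, hF'⟩ := hT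
  refine ⟨(fun t : G => t • b) '' F, hF.image _, ?_⟩
  rintro _ ⟨t, ht, rfl⟩
  obtain ⟨k, hk, hkv⟩ := hF' _ ht
  exact ⟨k, hk, k • t, hkv, by simp [mul_smul]⟩

theorem Small.of_finiteIndex (hS : Small H S) (hf : (K.subgroupOf H).FiniteIndex) :
    Small K S := by
  obtain ⟨F, hF, hF'⟩ := hS
  have : Finite (H ⧸ K.subgroupOf H) := Subgroup.finite_quotient_of_finiteIndex
  refine ⟨⋃ c : H ⧸ K.subgroupOf H, (fun x => (c.out : G)⁻¹ • x) '' F,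
    Set.finite_iUnion fun c => hF.image _, ?_⟩
  intro v hv
  obtain ⟨h, hh, hhv⟩ := hF' v hv
  let c : H ⧸ K.subgroupOf H := QuotientGroup.mk ⟨h, hh⟩
  have hc : c.out⁻¹ * ⟨h, hh⟩ ∈ K.subgroupOf H :=
    QuotientGroup.eq.1 (QuotientGroup.out_eq' c)
  refine ⟨(c.out : G)⁻¹ * h, by simpa [Subgroup.mem_subgroupOf] using hc, ?_⟩
  exact Set.mem_iUnion.2 ⟨c, h • v, hhv, by simp [mul_smul]⟩

theorem finiteIndex_of_small (hKH : K ≤ H) (h : Small K (H : Set G)) : (K.subgroupOf H).FiniteIndex := by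
  obtain ⟨F, hF, hF'⟩ := h
  rw [Subgroup.finiteIndex_iff_finite_quotient]
  have : Finite {x : H | (x : G) ∈ F} := by
    have := hF.preimage (f := ((↑) : H → G)) Subtype.val_injective.injOn
    exact this
  refine Finite.of_surjective
    -- Orbits of left multiplication by `K` are right cosets; inversion turns them into left cosets.
    (fun x : {x : H | (x : G) ∈ F} => (QuotientGroup.mk (x : H)⁻¹ : H ⧸ K.subgroupOf H)) ?_
  intro q
  obtain ⟨h, rfl⟩ := QuotientGroup.mk_surjective q
  obtain ⟨k, hk, hkh⟩ := hF' (h⁻¹ : H) (h⁻¹).2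
  refine ⟨⟨⟨k, hKH hk⟩ * h⁻¹, by simpa using hkh⟩, ?_⟩
  refine QuotientGroup.eq.2 ?_
  simpa [Subgroup.mem_subgroupOf] using hk

end Small
-- Almost invariant sets in a cofinite free graph
section Graph

variable {G : Type*} [Group G] {V : Type*} [MulAction G V] {K H : Subgroup G}
  {Γ : SimpleGraph V} {B P : Set V}

/-- The vertices outside `B` which are adjacent to a vertex of `B`. -/
def outerBoundary (Γ : SimpleGraph V) (B : Set V) : Set V :=
  {w | w ∉ B ∧ ∃ v ∈ B, Γ.Adj v w}

theorem outerBoundary_inter_subset (B B' : Set V) :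
    outerBoundary Γ (B ∩ B') ⊆ outerBoundary Γ B ∪ outerBoundary Γ B' := by
  rintro w ⟨hw, v, ⟨hv, hv'⟩, h⟩
  by_cases hwB : w ∈ B
  · exact Or.inr ⟨fun hwB' => hw ⟨hwB, hwB'⟩, v, hv', h⟩
  · exact Or.inl ⟨hwB, v, hv, h⟩

theorem outerBoundary_compl_subset (B : Set V) :
    outerBoundary Γ Bᶜ ⊆ {w | ∃ v ∈ outerBoundary Γ B, Γ.Adj v w} := by
  rintro w ⟨hw, v, hv, h⟩
  exact ⟨v, ⟨hv, w, not_not.1 hw, h.symm⟩, h⟩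

theorem exists_mem_support_outerBoundary {a b : V} (p : Γ.Walk a b)
    (ha : a ∈ B) (hb : b ∉ B) : ∃ x ∈ p.support, x ∈ outerBoundary Γ B := by
  induction p with
  | nil => exact absurd ha hb
  | @cons u v w h p ih =>
    by_cases hv : v ∈ B
    · obtain ⟨x, hx, hxB⟩ := ih hv hb
      exact ⟨x, by simp [hx], hxB⟩
    · exact ⟨v, by simp, hv, u, ha, h⟩

/-- From a vertex off `P`, one reaches off `P` either a neighbour of `P` or any given vertex. -/
theorem exists_reachable_off {y z : V} (p : Γ.Walk y z) (hy : y ∉ P) :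
    ∃ t, ((∃ u ∈ P, Γ.Adj u t) ∨ t = z) ∧
      ∀ B, outerBoundary Γ B ⊆ P → (y ∈ B ↔ t ∈ B) := by
  induction p with
  | nil => exact ⟨_, Or.inr rfl, fun _ _ => Iff.rfl⟩
  | @cons y u z h p ih =>
    by_cases hu : u ∈ P
    · exact ⟨y, Or.inl ⟨u, hu, h.symm⟩, fun _ _ => Iff.rfl⟩
    · obtain ⟨t, ht, htB⟩ := ih hu
      refine ⟨t, ht, fun B hB => Iff.trans ⟨fun hyB => ?_, fun huB => ?_⟩ (htB B hB)⟩
      · by_contra huB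
        exact hu (hB ⟨huB, y, hyB, h⟩)
      · by_contra hyB
        exact hy (hB ⟨hyB, u, huB, h.symm⟩)

/-- A connected graph on which `G` acts freely on vertices, with finitely many orbits of vertices
and of adjacent pairs. -/
structure IsCofiniteFree (G : Type*) [Group G] {V : Type*} [MulAction G V]
    (Γ : SimpleGraph V) : Prop where
  connected : Γ.Connected
  smul_adj : ∀ (g : G) (v w : V), Γ.Adj v w → Γ.Adj (g • v) (g • w)
  free : ∀ (g : G) (v : V), g • v = v → g = 1
  exists_vertex_reps : ∃ O : Set V, O.Finite ∧ ∀ v, ∃ g : G, ∃ r ∈ O, g • r = v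
  exists_edge_reps : ∃ R : Set (V × V), R.Finite ∧
    ∀ v w, Γ.Adj v w → ∃ g : G, ∃ p ∈ R, g • p.1 = v ∧ g • p.2 = w

/-- A set of vertices is almost invariant if its outer boundary is small. -/
def AlmostInvariant (K : Subgroup G) (Γ : SimpleGraph V) (B : Set V) : Prop :=
  Small K (outerBoundary Γ B)

/-- A family of `n` disjoint almost invariant sets of vertices which are not small. -/
structure IsEndFamily (K : Subgroup G) (Γ : SimpleGraph V) {n : ℕ}
    (A : Fin n → Set V) : Prop where
  disjoint : ∀ i j, i ≠ j → Disjoint (A i) (A j)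
  almostInvariant : ∀ i, AlmostInvariant K Γ (A i)
  not_small : ∀ i, ¬ Small K (A i)

namespace IsCofiniteFree

variable (hΓ : IsCofiniteFree G Γ)
include hΓ

theorem outerBoundary_smul_mem_subset (g : G) (B : Set V) :
    outerBoundary Γ {v | g • v ∈ B} ⊆ {v | g • v ∈ outerBoundary Γ B} := by
  rintro w ⟨hw, v, hv, h⟩
  exact ⟨hw, g • v, hv, hΓ.smul_adj g v w h⟩

theorem small_neighbors {P : Set V} (hP : Small K P) :
    Small K {w | ∃ v ∈ P, Γ.Adj v w} := by
  obtain ⟨R, hR, hR'⟩ := hΓ.exists_edge_reps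
  refine (Small.biUnion hR (S := fun p => {w | ∃ t ∈ {t : G | t • p.1 ∈ P}, t • p.2 = w})
    fun p _ => (hP.orbit_preimage hΓ.free p.1).orbit_image p.2).mono ?_
  rintro w ⟨v, hv, h⟩
  obtain ⟨g, p, hp, rfl, rfl⟩ := hR' v w h
  exact ⟨p, hp, g, hv, rfl⟩

/-- Fix a path from `a` to `b`. Its translate by `g` leaves `B`, so `g` carries one of finitely many
vertices into the small outer boundary. -/
theorem small_crossing (hB : AlmostInvariant K Γ B) (a b : V) :
    Small K {g : G | g • a ∈ B ∧ g • b ∉ B} := by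
  obtain ⟨p⟩ := hΓ.connected.preconnected a b
  refine (Small.biUnion (I := {x | x ∈ p.support}) p.support.finite_toSet
    (S := fun x => {g : G | g • x ∈ outerBoundary Γ B})
    fun x _ => Small.orbit_preimage hΓ.free hB x).mono ?_
  rintro g ⟨ha, hb⟩
  obtain ⟨x, hx, hxB⟩ := exists_mem_support_outerBoundary (B := {v | g • v ∈ B}) p ha hb
  exact ⟨x, hx, hΓ.outerBoundary_smul_mem_subset g B hxB⟩

theorem almostInvariant_compl (hB : AlmostInvariant K Γ B) : AlmostInvariant K Γ Bᶜ :=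
  (hΓ.small_neighbors hB).mono (outerBoundary_compl_subset B)

theorem almostInvariant_diff {B' : Set V} (hB : AlmostInvariant K Γ B)
    (hB' : AlmostInvariant K Γ B') : AlmostInvariant K Γ (B \ B') :=
  (Small.union hB (hΓ.almostInvariant_compl hB')).mono (outerBoundary_inter_subset B B'ᶜ)

theorem almostInvariant_smul_mem {h : G} (hh : h ∈ H) (hB : AlmostInvariant H Γ B) :
    AlmostInvariant H Γ {v | h • v ∈ B} :=
  (Small.smul_mem hB hh).mono (hΓ.outerBoundary_smul_mem_subset h B)

/-- The small sets with outer boundary in a given small invariant set are uniformly small. -/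
theorem exists_small_bound (hP : Small H P) (hinv : ∀ h ∈ H, ∀ v ∈ P, h • v ∈ P) :
    ∃ Q, Small H Q ∧ ∀ B, Small H B → outerBoundary Γ B ⊆ P → B ⊆ Q := by
  obtain ⟨v₀⟩ := hΓ.connected.nonempty
  obtain ⟨F, hF, hF'⟩ := (hΓ.small_neighbors hP).union
    (small_of_finite (K := H) (Set.finite_singleton v₀))
  -- One set `B₀ t` serves as witness for every admissible `B` containing `t`; it is empty if there
  -- is none.
  have key : ∀ t : V, ∃ B₀ : Set V, Small H B₀ ∧ outerBoundary Γ B₀ ⊆ P ∧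
      ∀ B, Small H B → outerBoundary Γ B ⊆ P → t ∈ B → t ∈ B₀ := by
    intro t
    by_cases h : ∃ B, Small H B ∧ outerBoundary Γ B ⊆ P ∧ t ∈ B
    · obtain ⟨B, h₁, h₂, h₃⟩ := h
      exact ⟨B, h₁, h₂, fun _ _ _ _ => h₃⟩
    · exact ⟨∅, small_of_finite Set.finite_empty, fun w hw => by simp [outerBoundary] at hw,
        fun B h₁ h₂ h₃ => (h ⟨B, h₁, h₂, h₃⟩).elim⟩
  choose B₀ h₀ hb₀ hm₀ using key
  have trans : ∀ h ∈ H, ∀ B, outerBoundary Γ B ⊆ P →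
      outerBoundary Γ {v | h • v ∈ B} ⊆ P := by
    intro h hh B hB w hw
    have := hinv h⁻¹ (H.inv_mem hh) _ (hB (hΓ.outerBoundary_smul_mem_subset h B hw))
    simpa using this
  refine ⟨P ∪ {v | ∃ h ∈ H, h • v ∈ {v | ∃ t ∈ F, v ∈ B₀ t}},
    hP.union (Small.biUnion hF fun t _ => h₀ t).saturate, fun B hB hBP y hy => ?_⟩
  by_cases hyP : y ∈ P
  · exact Or.inl hyP
  right
  obtain ⟨p⟩ := hΓ.connected.preconnected y v₀
  -- No set with outer boundary in `P` separates `y` from `t`, and modulo `H` there are only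
  -- finitely many such `t`.
  obtain ⟨t, ht, htB⟩ := exists_reachable_off p hyP
  obtain ⟨h, hh, hht⟩ := hF' t (ht.imp id fun h => h)
  refine ⟨h, hh, h • t, hht, ?_⟩
  refine (htB {v | h • v ∈ B₀ (h • t)} (trans h hh _ (hb₀ _))).2 ?_
  refine hm₀ (h • t) {v | h⁻¹ • v ∈ B} (hB.smul_mem (H.inv_mem hh))
    (trans _ (H.inv_mem hh) _ hBP) ?_
  simpa using (htB B hBP).1 hy

/-- If the whole graph is not `H`-small, an `H`-small set which is almost invariant relative to a
subgroup `K ≤ H` is `K`-small. -/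
theorem small_of_small (hV : ¬ Small H (Set.univ : Set V)) (hB : AlmostInvariant K Γ B)
    (hBH : Small H B) : Small K B := by
  obtain ⟨F, hF, hF'⟩ := hBH
  -- The `H`-orbit of `y` misses `B`, so whenever `h⁻¹ • x ∈ B` with `h ∈ H`, `h⁻¹` sends `x` into
  -- `B` and `y` out of it.
  obtain ⟨y, hy⟩ : ∃ y, ∀ h ∈ H, h • y ∉ F := by
    by_contra! hcon
    exact hV ⟨F, hF, fun v _ => hcon v⟩
  refine (Small.biUnion hF
    (S := fun x => {v | ∃ t ∈ {g : G | g • x ∈ B ∧ g • y ∉ B}, t • x = v})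
    fun x _ => (hΓ.small_crossing hB x y).orbit_image x).mono ?_
  intro v hv
  obtain ⟨h, hh, hhv⟩ := hF' v hv
  refine ⟨_, hhv, h⁻¹, ⟨by simpa using hv, fun hyB => ?_⟩, by simp⟩
  obtain ⟨k, hk, hky⟩ := hF' _ hyB
  exact hy (k * h⁻¹) (H.mul_mem hk (H.inv_mem hh)) (by rwa [mul_smul])

end IsCofiniteFree
end Graph
-- Maximal end families, the index bound and change of graph
section Families

variable {G : Type*} [Group G] {V : Type*} [MulAction G V] {K H : Subgroup G}
  {Γ : SimpleGraph V}

namespace IsEndFamily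

theorem congr_small (h : ∀ S : Set V, Small K S ↔ Small H S) {n : ℕ} {A : Fin n → Set V} :
    IsEndFamily K Γ A ↔ IsEndFamily H Γ A :=
  ⟨fun hA => ⟨hA.disjoint, fun i => (h _).1 (hA.almostInvariant i),
      fun i hi => hA.not_small i ((h _).2 hi)⟩,
    fun hA => ⟨hA.disjoint, fun i => (h _).2 (hA.almostInvariant i),
      fun i hi => hA.not_small i ((h _).1 hi)⟩⟩

variable {n : ℕ} {A : Fin n → Set V}

/-- A member of a maximal end family is almost contained in any given almost invariant set that is
not small. -/
theorem exists_small_diff (hΓ : IsCofiniteFree G Γ) (hA : IsEndFamily K Γ A)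
    (hmax : ¬ ∃ A' : Fin (n + 1) → Set V, IsEndFamily K Γ A') {D : Set V}
    (hD : AlmostInvariant K Γ D) (hDs : ¬ Small K D) : ∃ i, Small K (A i \ D) := by
  by_contra! hcon
  -- Otherwise `D` and the sets `A i \ D` form a larger family.
  refine hmax ⟨Fin.cons D fun i => A i \ D, ?_, ?_, ?_⟩
  · intro i j
    refine Fin.cases ?_ (fun i => ?_) i <;> refine Fin.cases ?_ (fun j => ?_) j
    · exact fun h => (h rfl).elim
    · exact fun _ => by simpa using Set.disjoint_sdiff_right
    · exact fun _ => by simpa using Set.disjoint_sdiff_left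
    · intro h
      simpa using (hA.disjoint i j fun hij => h (by rw [hij])).mono Set.sdiff_subset Set.sdiff_subset
  · exact Fin.cases (by simpa using hD) fun i => by
      simpa using hΓ.almostInvariant_diff (hA.almostInvariant i) hD
  · exact Fin.cases (by simpa using hDs) fun i => by simpa using hcon i

/-- An almost invariant set is determined, up to small sets, by the members of a maximal end family
that it meets in a set which is not small. -/
theorem small_diff_of_forall_iff (hΓ : IsCofiniteFree G Γ) (hA : IsEndFamily K Γ A)
    (hmax : ¬ ∃ A' : Fin (n + 1) → Set V, IsEndFamily K Γ A') {X X' : Set V}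
    (hX : AlmostInvariant K Γ X) (hX' : AlmostInvariant K Γ X')
    (h : ∀ i, Small K (A i ∩ X) ↔ Small K (A i ∩ X')) : Small K (X \ X') := by
  by_contra hs
  -- Almost all of `A i` lies in `X \ X'`, so `A i ∩ X'` is small; by `h` so is `A i ∩ X`, and then
  -- `A i` itself.
  obtain ⟨i, hi⟩ := hA.exists_small_diff hΓ hmax (hΓ.almostInvariant_diff hX hX') hs
  have h₁ : Small K (A i ∩ X') := hi.mono fun v hv => ⟨hv.1, fun hv' => hv'.2 hv.2⟩
  refine hA.not_small i ((hi.union ((h i).2 h₁)).mono fun v hv => ?_)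
  by_cases hvX : v ∈ X
  · exact Or.inr ⟨hv, hvX⟩
  · exact Or.inl ⟨hv, fun hv' => hvX hv'.1⟩

end IsEndFamily

/-- If `H` has finitely many filtered ends, `K ≤ H` and some set of vertices is almost invariant
relative to `K` and neither small nor co-small, then `K` has finite index in `H`. -/
theorem IsCofiniteFree.finiteIndex (hΓ : IsCofiniteFree G Γ) (hKH : K ≤ H)
    (hV : ¬ Small H (Set.univ : Set V)) {n : ℕ} {A : Fin n → Set V} (hA : IsEndFamily H Γ A)
    (hmax : ¬ ∃ A' : Fin (n + 1) → Set V, IsEndFamily H Γ A') {B : Set V}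
    (hB : AlmostInvariant K Γ B) (hBs : ¬ Small K B) (hBcs : ¬ Small K Bᶜ) :
    (K.subgroupOf H).FiniteIndex := by
  have hBc := hΓ.almostInvariant_compl hB
  have hBH : ¬ Small H B := fun h => hBs (hΓ.small_of_small hV hB h)
  have hBcH : ¬ Small H Bᶜ := fun h => hBcs (hΓ.small_of_small hV hBc h)
  have hBA : AlmostInvariant H Γ B := Small.of_le hB hKH
  -- `P` contains the outer boundaries of all differences of translates of `B` by `H`.
  let P : Set V := {v | ∃ h ∈ H, h • v ∈ outerBoundary Γ B ∪ outerBoundary Γ Bᶜ}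
  have hP : Small H P := ((Small.union hB hBc).of_le hKH).saturate
  obtain ⟨Q, hQ, hQ'⟩ := hΓ.exists_small_bound hP (by
    rintro h hh v ⟨k, hk, hkv⟩
    exact ⟨k * h⁻¹, H.mul_mem hk (H.inv_mem hh), by simpa [mul_smul] using hkv⟩)
  have hbd : ∀ h ∈ H, ∀ h' ∈ H,
      outerBoundary Γ ({v | h • v ∈ B} \ {v | h' • v ∈ B}) ⊆ P := by
    intro h hh h' hh' v hv
    rcases outerBoundary_inter_subset {v | h • v ∈ B} {v | h' • v ∈ Bᶜ} hv with hv | hv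
    · exact ⟨h, hh, Or.inl (hΓ.outerBoundary_smul_mem_subset h B hv)⟩
    · exact ⟨h', hh', Or.inr (hΓ.outerBoundary_smul_mem_subset h' Bᶜ hv)⟩
  let code : G → Set (Fin n) := fun h => {i | Small H (A i ∩ {v | h • v ∈ B})}
  have hdiff : ∀ h ∈ H, ∀ h' ∈ H, code h = code h' →
      {v | h • v ∈ B} \ {v | h' • v ∈ B} ⊆ Q := fun h hh h' hh' hc =>
    hQ' _ (hA.small_diff_of_forall_iff hΓ hmax (hΓ.almostInvariant_smul_mem hh hBA)
      (hΓ.almostInvariant_smul_mem hh' hBA) fun i => Set.ext_iff.1 hc i) (hbd h hh h' hh')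
  have hfar : ∀ h ∈ H, ∀ S : Set V, ¬ Small H S → ∃ a, h • a ∈ S ∧ a ∉ Q := by
    intro h hh S hS
    by_contra! hcon
    refine hS ((hQ.smul_mem (H.inv_mem hh)).mono fun v hv => hcon _ (by simpa using hv))
  refine finiteIndex_of_small hKH ((Small.biUnion (Set.finite_univ (α := Set (Fin n)))
    (S := fun c => {h | h ∈ H ∧ code h = c}) fun c _ => ?_).mono
      fun h hh => ⟨code h, Set.mem_univ _, hh, rfl⟩)
  by_cases hc : ∃ h₀ ∈ H, code h₀ = c
  · obtain ⟨h₀, hh₀, rfl⟩ := hc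
    obtain ⟨a, ha, haQ⟩ := hfar h₀ hh₀ B hBH
    obtain ⟨b, hb, hbQ⟩ := hfar h₀ hh₀ Bᶜ hBcH
    refine (hΓ.small_crossing hB a b).mono ?_
    rintro h ⟨hh, hc⟩
    constructor
    · by_contra h₁
      exact haQ (hdiff h₀ hh₀ h hh hc.symm ⟨ha, h₁⟩)
    · intro h₁
      exact hbQ (hdiff h hh h₀ hh₀ hc ⟨h₁, hb⟩)
  · exact (small_of_finite Set.finite_empty).mono fun h hh => (hc ⟨h, hh⟩).elim

/-- All orbit representatives are sent to one point `w`; by freeness the element moving the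
representative to `v` is unique, which gives equivariance. -/
theorem IsCofiniteFree.exists_equivariant (hΓ : IsCofiniteFree G Γ) {V' : Type*} [MulAction G V']
    [Nonempty V'] : ∃ f : V → V', ∀ (g : G) (v : V), f (g • v) = g • f v := by
  obtain ⟨w⟩ := ‹Nonempty V'›
  have key : ∀ v : V, ∃ g : G, g • (Quotient.mk (MulAction.orbitRel G V) v).out = v :=
    fun v => MulAction.mem_orbit_iff.1
      (MulAction.orbitRel_apply.1 ((MulAction.orbitRel G V).symm (Quotient.mk_out (s := MulAction.orbitRel G V) v)))
  choose γ hγ using key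
  refine ⟨fun v => γ v • w, fun g v => ?_⟩
  change γ (g • v) • w = g • γ v • w
  rw [smul_smul]
  congr 1
  have h₁ : Quotient.mk (MulAction.orbitRel G V) (g • v) =
      Quotient.mk (MulAction.orbitRel G V) v :=
    Quotient.sound ⟨g, rfl⟩
  have h₂ := hγ (g • v)
  rw [h₁] at h₂
  have h₃ : ((g * γ v)⁻¹ * γ (g • v)) • (Quotient.mk (MulAction.orbitRel G V) v).out
      = (Quotient.mk (MulAction.orbitRel G V) v).out := by
    rw [mul_smul, h₂, inv_smul_eq_iff, mul_smul, hγ]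
  exact (inv_mul_eq_one.1 (hΓ.free _ _ h₃)).symm

/-- End families can be pulled back along equivariant maps. -/
theorem IsEndFamily.comap (hΓ : IsCofiniteFree G Γ) {V' : Type*} [MulAction G V']
    {Γ' : SimpleGraph V'} (hΓ' : IsCofiniteFree G Γ') {f : V → V'}
    (hf : ∀ (g : G) (v : V), f (g • v) = g • f v) {n : ℕ} {A : Fin n → Set V'}
    (hA : IsEndFamily K Γ' A) : IsEndFamily K Γ fun i => f ⁻¹' A i := by
  refine ⟨fun i j h => (hA.disjoint i j h).preimage f, fun i => ?_, fun i hi => ?_⟩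
  -- The images of adjacent vertices need not be adjacent, but `small_crossing` applies to any pair.
  · obtain ⟨R, hR, hR'⟩ := hΓ.exists_edge_reps
    refine (Small.biUnion hR (S := fun p => {w | ∃ t ∈
      {t : G | t • f p.1 ∈ A i ∧ t • f p.2 ∉ A i}, t • p.2 = w}) fun p _ =>
        (hΓ'.small_crossing (hA.almostInvariant i) _ _).orbit_image p.2).mono ?_
    rintro w ⟨hw, v, hv, h⟩
    obtain ⟨g, p, hp, rfl, rfl⟩ := hR' v w h
    exact ⟨p, hp, g, ⟨by simpa [hf] using hv, by simpa [hf] using hw⟩, rfl⟩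
  · obtain ⟨v₀⟩ := hΓ.connected.nonempty
    obtain ⟨O, hO, hO'⟩ := hΓ'.exists_vertex_reps
    -- For `g • r ∈ A i`, either `g • f v₀ ∈ A i`, so `g • v₀` lies in the small preimage, or `g`
    -- separates `r` from `f v₀`.
    refine hA.not_small i ((Small.biUnion hO (S := fun r => {w | ∃ t ∈
      {t : G | t • v₀ ∈ f ⁻¹' A i} ∪ {t : G | t • r ∈ A i ∧ t • f v₀ ∉ A i}, t • r = w}) fun r _ =>
        ((hi.orbit_preimage hΓ.free v₀).union
          (hΓ'.small_crossing (hA.almostInvariant i) _ _)).orbit_image r).mono ?_)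
    intro w hw
    obtain ⟨g, r, hr, rfl⟩ := hO' w
    refine ⟨r, hr, g, ?_, rfl⟩
    by_cases h : g • f v₀ ∈ A i
    · exact Or.inl (by simpa [hf] using h)
    · exact Or.inr ⟨hw, h⟩

theorem IsCofiniteFree.exists_isEndFamily_congr (hΓ : IsCofiniteFree G Γ) {V' : Type*}
    [MulAction G V'] {Γ' : SimpleGraph V'} (hΓ' : IsCofiniteFree G Γ') (n : ℕ) :
    (∃ A : Fin n → Set V, IsEndFamily K Γ A) ↔ ∃ A : Fin n → Set V', IsEndFamily K Γ' A := by
  have := hΓ.connected.nonempty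
  have := hΓ'.connected.nonempty
  constructor
  · rintro ⟨A, hA⟩
    obtain ⟨f, hf⟩ := hΓ'.exists_equivariant (V' := V)
    exact ⟨_, hA.comap hΓ' hΓ hf⟩
  · rintro ⟨A, hA⟩
    obtain ⟨f, hf⟩ := hΓ.exists_equivariant (V' := V')
    exact ⟨_, hA.comap hΓ hΓ' hf⟩

end Families
-- Ends as inverse limits and end families
section Ends

open SimpleGraph

variable {G : Type*} [Group G] {V E : Type*} [MulAction G V] [MulAction G E] {H : Subgroup G}

theorem GGraph.IsUniversalCoverSkeleton.isCofiniteFree {Y : GGraph G V E}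
    (hY : Y.IsUniversalCoverSkeleton) : IsCofiniteFree G Y.toSimpleGraph where
  connected := hY.connected
  smul_adj := by
    rintro g v w ⟨hne, e, he⟩
    exact ⟨fun h => hne (smul_left_cancel g h), g • e, by rw [Y.ends_smul, he, Sym2.map_mk]⟩
  free := hY.free_verts
  exists_vertex_reps := by
    have := hY.finite_verts
    refine ⟨Set.range (Quotient.out : MulAction.orbitRel.Quotient G V → V),
      Set.finite_range _, fun v => ?_⟩
    obtain ⟨g, hg⟩ := MulAction.orbitRel_apply.1
      ((MulAction.orbitRel G V).symm (Quotient.mk_out (s := MulAction.orbitRel G V) v))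
    exact ⟨g, _, ⟨_, rfl⟩, hg⟩
  exists_edge_reps := by
    have := hY.finite_edges
    refine ⟨⋃ c : MulAction.orbitRel.Quotient G E, {p : V × V | s(p.1, p.2) = Y.ends c.out},
      Set.finite_iUnion fun c => ?_, ?_⟩
    · induction Y.ends c.out with
      | _ x y =>
        refine (Set.toFinite {(x, y), (y, x)}).subset fun p hp => ?_
        rcases Sym2.eq_iff.1 hp with ⟨h₁, h₂⟩ | ⟨h₁, h₂⟩
        · exact Or.inl (Prod.ext h₁ h₂)
        · exact Or.inr (Prod.ext h₁ h₂)
    · rintro v w ⟨-, e, he⟩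
      obtain ⟨g, hg⟩ := MulAction.orbitRel_apply.1
        ((MulAction.orbitRel G E).symm (Quotient.mk_out (s := MulAction.orbitRel G E) e))
      refine ⟨g, (g⁻¹ • v, g⁻¹ • w), Set.mem_iUnion.2 ⟨Quotient.mk _ e, ?_⟩, by simp, by simp⟩
      have hg' : (Quotient.mk (MulAction.orbitRel G E) e).out = g⁻¹ • e := by
        rw [eq_inv_smul_iff]
        exact hg
      change s(g⁻¹ • v, g⁻¹ • w) = Y.ends (Quotient.mk (MulAction.orbitRel G E) e).out
      rw [hg', Y.ends_smul, he, Sym2.map_mk]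

theorem outerBoundary_supp_subset {Γ : SimpleGraph V} {P : Set V} (c : Γ.ComponentCompl P) :
    outerBoundary Γ (c : Set V) ⊆ P := by
  rintro w ⟨hw, v, hv, h⟩
  by_contra hwP
  exact hw (ComponentCompl.mem_of_adj v w hv hwP h)

theorem supp_subset_of_mem {Γ : SimpleGraph V} {P U : Set V} (hU : outerBoundary Γ U ⊆ P)
    {v : V} (hvP : v ∉ P) (hv : v ∈ U) : (Γ.componentComplMk hvP : Set V) ⊆ U := by
  rintro w ⟨hwP, hw⟩
  obtain ⟨p⟩ := ConnectedComponent.exact hw.symm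
  by_contra hwU
  obtain ⟨⟨x, hxP⟩, -, hx, y, hy, h⟩ := exists_mem_support_outerBoundary
    (B := {x : (Pᶜ : Set V) | (x : V) ∈ U}) p hv hwU
  exact hxP (hU ⟨hx, y, hy, h⟩)

/-- Infinitely many small components could have a large union; the uniform bound `Q` on small
components rules this out, so any vertex of `U` off `P ∪ Q` lies in a large one. -/
theorem IsCofiniteFree.exists_component {Γ : SimpleGraph V} (hΓ : IsCofiniteFree G Γ)
    {P U : Set V} (hP : Small H P) (hinv : ∀ h ∈ H, ∀ v ∈ P, h • v ∈ P)
    (hU : outerBoundary Γ U ⊆ P) (hUs : ¬ Small H U) :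
    ∃ c : Γ.ComponentCompl P, (c : Set V) ⊆ U ∧ ¬ Small H (c : Set V) := by
  obtain ⟨Q, hQ, hQ'⟩ := hΓ.exists_small_bound hP hinv
  obtain ⟨v, hv, hvPQ⟩ : ∃ v ∈ U, v ∉ P ∪ Q := by
    by_contra! hcon
    exact hUs ((hP.union hQ).mono hcon)
  have hvP : v ∉ P := fun h => hvPQ (Or.inl h)
  exact ⟨Γ.componentComplMk hvP, supp_subset_of_mem hU hvP hv, fun hs =>
    hvPQ (Or.inr (hQ' _ hs (outerBoundary_supp_subset _) (componentComplMk_mem _ hvP)))⟩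

variable {Y : GGraph G V E} {C : (Y.quotient H).Filtration}

theorem small_pullback (hC : C.IsFinite) (n : ℕ) :
    Small H ((Y.pullback H C).sub n).verts := by
  refine ⟨(Quotient.out : MulAction.orbitRel.Quotient H V → V) '' (C.sub n).verts,
    (hC n).1.image _, fun v hv => ?_⟩
  obtain ⟨h, hh⟩ := MulAction.orbitRel_apply.1 (Quotient.mk_out (s := MulAction.orbitRel H V) v)
  exact ⟨h, h.2, Quotient.mk _ v, hv, hh.symm⟩

theorem smul_mem_pullback (n : ℕ) {h : G} (hh : h ∈ H) {v : V}
    (hv : v ∈ ((Y.pullback H C).sub n).verts) : h • v ∈ ((Y.pullback H C).sub n).verts := by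
  have : (Quotient.mk _ (h • v) : MulAction.orbitRel.Quotient H V) = Quotient.mk _ v :=
    Quotient.sound ⟨⟨h, hh⟩, rfl⟩
  change (Quotient.mk _ (h • v) : MulAction.orbitRel.Quotient H V) ∈ (C.sub n).verts
  rw [this]
  exact hv

/-- Some level contains the finitely many representatives, and every level is `H`-invariant. -/
theorem Small.exists_subset_pullback {S : Set V} (hS : Small H S) :
    ∃ n, ∀ m, n ≤ m → S ⊆ ((Y.pullback H C).sub m).verts := by
  obtain ⟨F, hF, hF'⟩ := hS
  choose l hl using (Y.pullback H C).exists_mem_verts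
  obtain ⟨n, hn⟩ := (hF.image l).bddAbove
  refine ⟨n, fun m hm v hv => ?_⟩
  obtain ⟨h, hh, hhv⟩ := hF' v hv
  have := smul_mem_pullback m (H.inv_mem hh) ((Y.pullback H C).verts_mono
    ((hn ⟨_, hhv, rfl⟩).trans hm) (hl (h • v)))
  simpa using this

/-- Every large component at some level contains an end. -/
theorem exists_end (hY : Y.IsUniversalCoverSkeleton) (hC : C.IsFinite) (m : ℕ)
    (c : Y.toCWGraph.PiZeroCompl ((Y.pullback H C).sub m)) (hc : ¬ Small H (c : Set V)) :
    ∃ s : Y.toCWGraph.EndLimit (Y.pullback H C), s.1 m = c := by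
  have step : ∀ j : ℕ, ∀ c : {c : Y.toCWGraph.PiZeroCompl ((Y.pullback H C).sub j) //
      ¬ Small H (c : Set V)}, ∃ c' : {c : Y.toCWGraph.PiZeroCompl ((Y.pullback H C).sub (j + 1)) //
      ¬ Small H (c : Set V)}, c'.1.hom ((Y.pullback H C).verts_mono j.le_succ) = c.1 := by
    rintro j ⟨c, hc⟩
    obtain ⟨c', hc', hs⟩ := hY.isCofiniteFree.exists_component (small_pullback hC (j + 1))
      (fun h hh v hv => smul_mem_pullback (j + 1) hh hv)
      ((outerBoundary_supp_subset c).trans ((Y.pullback H C).verts_mono j.le_succ)) hc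
    exact ⟨⟨c', hs⟩, (ComponentCompl.hom_eq_iff_le _ _ _).2 hc'⟩
  choose next hnext using step
  let t : ∀ j : ℕ, {c : Y.toCWGraph.PiZeroCompl ((Y.pullback H C).sub (m + j)) //
      ¬ Small H (c : Set V)} := fun j => Nat.rec ⟨c, hc⟩ (fun j c => next (m + j) c) j
  have ht : ∀ i j (hij : i ≤ j),
      (t j).1.hom ((Y.pullback H C).verts_mono (Nat.add_le_add_left hij m)) = (t i).1 := by
    intro i j hij
    induction j, hij using Nat.le_induction with
    | base => exact ComponentCompl.hom_refl _
    | succ j hij ih =>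
      rw [ComponentCompl.hom_trans _ ((Y.pullback H C).verts_mono (m + j).le_succ)
        ((Y.pullback H C).verts_mono (Nat.add_le_add_left hij m)), ← ih]
      congr 1
      exact hnext (m + j) (t j)
  -- The coordinate at level `n` is projected down from level `m + n`, which also defines it for `n
  -- < m`.
  refine ⟨⟨fun n => (t n).1.hom ((Y.pullback H C).verts_mono (Nat.le_add_left n m)),
    fun i j hij => ?_⟩, ht 0 m m.zero_le⟩
  change _ = (t i).1.hom _
  rw [← ComponentCompl.hom_trans, ← ht i j hij, ← ComponentCompl.hom_trans]

/-- A small component would be swallowed by a later level, yet it contains the nonempty later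
coordinates of `s`, which avoid that level. -/
theorem EndLimit.not_small (s : Y.toCWGraph.EndLimit (Y.pullback H C)) (n : ℕ) :
    ¬ Small H (s.1 n : Set V) := by
  intro hs
  obtain ⟨m, hm⟩ := hs.exists_subset_pullback (Y := Y) (C := C)
  obtain ⟨v, hv⟩ := (s.1 (max m n)).nonempty
  have hvn : v ∈ (s.1 n : Set V) := by
    rw [← s.2 n (max m n) (le_max_right _ _)]
    exact ComponentCompl.subset_hom _ _ hv
  exact ComponentCompl.notMem_of_mem hv (hm _ (le_max_left _ _) hvn)

theorem natCast_le_card_iff {α : Type*} {k : ℕ} :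
    (k : ℕ∞) ≤ ENat.card α ↔ ∃ s : Fin k → α, Function.Injective s := by
  constructor
  · intro h
    rw [ENat.card, Cardinal.natCast_le_toENat] at h
    obtain ⟨f⟩ := Cardinal.lift_mk_le'.1
      (show Cardinal.lift (Cardinal.mk (Fin k)) ≤ Cardinal.lift.{0} (Cardinal.mk α) by simpa using h)
    exact ⟨f, f.injective⟩
  · rintro ⟨s, hs⟩
    simpa using ENat.card_le_card_of_injective hs

/-- The number of filtered ends is the largest size of an end family. -/
theorem le_filteredEnds_iff (hY : Y.IsUniversalCoverSkeleton) (hC : C.IsFinite) (k : ℕ) :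
    (k : ℕ∞) ≤ Y.filteredEnds H C ↔ ∃ A : Fin k → Set V, IsEndFamily H Y.toSimpleGraph A := by
  rw [GGraph.filteredEnds, CWGraph.numFilteredEnds, natCast_le_card_iff]
  constructor
  · rintro ⟨s, hs⟩
    -- Ends that differ at one level differ at all later ones, so a common level separates the
    -- finitely many pairs.
    have hlevel : ∀ p : Fin k × Fin k, ∃ n, p.1 ≠ p.2 → (s p.1).1 n ≠ (s p.2).1 n := by
      rintro ⟨i, j⟩
      by_cases hij : i = j
      · exact ⟨0, fun h => (h hij).elim⟩
      · by_contra! hcon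
        exact hij (hs (Subtype.ext (funext fun n => (hcon n).2)))
    choose l hl using hlevel
    obtain ⟨n, hn⟩ := (Set.finite_range l).bddAbove
    refine ⟨fun i => ((s i).1 n : Set V), fun i j hij => ?_, fun i => ?_,
      fun i => EndLimit.not_small (s i) n⟩
    · refine ComponentCompl.pairwise_disjoint fun h => hl (i, j) hij ?_
      rw [← (s i).2 _ n (hn ⟨(i, j), rfl⟩), ← (s j).2 _ n (hn ⟨(i, j), rfl⟩), h]
    · exact (small_pullback hC n).mono (outerBoundary_supp_subset _)
  · rintro ⟨A, hA⟩
    -- One level swallows all the outer boundaries, so each `A i` contains a large component there,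
    -- and that component carries an end.
    choose l hl using fun i => Small.exists_subset_pullback (Y := Y) (C := C) (hA.almostInvariant i)
    obtain ⟨n, hn⟩ := (Set.finite_range l).bddAbove
    choose c hcA hcs using fun i => hY.isCofiniteFree.exists_component (small_pullback hC n)
      (fun h hh v hv => smul_mem_pullback n hh hv) (hl i n (hn ⟨i, rfl⟩)) (hA.not_small i)
    choose s hs using fun i => exists_end hY hC n (c i) (hcs i)
    refine ⟨s, fun i j hij => ?_⟩
    by_contra hne
    obtain ⟨v, hv⟩ := (c i).nonempty
    have hij' : c i = c j := by rw [← hs i, ← hs j, hij]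
    exact Set.disjoint_left.1 (hA.disjoint i j hne) (hcA i hv) (hcA j (hij' ▸ hv))

end Ends
end FilteredEnds

/-- If one computation of `e(G, H)` (from some universal cover skeleton `Y` and some finite
filtration `C` of `H \ Y`) gives `n`, a nonzero natural number, then every computation of
`e(G, K)` gives `n` or `1`, according as `[H : K]` is finite or infinite. -/
theorem corollary2 {G : Type*} [Group G] [Group.FG G] (K H : Subgroup G)
    (hKH : K ≤ H) (hHG : H < ⊤) (n : ℕ) (hn : n ≠ 0)
    {V E : Type*} [MulAction G V] [MulAction G E] (Y : FilteredEnds.GGraph G V E)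
    (hY : Y.IsUniversalCoverSkeleton)
    (C : (Y.quotient H).Filtration) (hC : C.IsFinite)
    (he : Y.filteredEnds H C = (n : ℕ∞))
    {V' E' : Type*} [MulAction G V'] [MulAction G E'] (Y' : FilteredEnds.GGraph G V' E')
    (hY' : Y'.IsUniversalCoverSkeleton)
    (D : (Y'.quotient K).Filtration) (hD : D.IsFinite) :
    ((K.subgroupOf H).FiniteIndex → Y'.filteredEnds K D = (n : ℕ∞)) ∧
      (¬ (K.subgroupOf H).FiniteIndex → Y'.filteredEnds K D = 1) := by
  -- Both numbers are read off from end families in the same graph `Y`.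
  have key : ∀ k : ℕ, (k : ℕ∞) ≤ Y'.filteredEnds K D ↔
      ∃ A : Fin k → Set V, FilteredEnds.IsEndFamily K Y.toSimpleGraph A := fun k => by
    rw [FilteredEnds.le_filteredEnds_iff hY' hD,
      hY.isCofiniteFree.exists_isEndFamily_congr hY'.isCofiniteFree]
  have keyH := FilteredEnds.le_filteredEnds_iff hY hC
  refine ⟨fun hf => ?_, fun hf => ?_⟩
  · rw [← he]
    refine ENat.eq_of_forall_natCast_le_iff fun k => ?_
    rw [key, keyH]
    exact exists_congr fun A => FilteredEnds.IsEndFamily.congr_small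
      (fun S => ⟨fun h => h.of_le hKH, fun h => h.of_finiteIndex hf⟩)
  · obtain ⟨A, hA⟩ := (keyH n).1 he.ge
    have hV : ¬ FilteredEnds.Small H (Set.univ : Set V) := fun h =>
      hA.not_small ⟨0, Nat.pos_of_ne_zero hn⟩ (h.mono (Set.subset_univ _))
    have hmax : ¬ ∃ A' : Fin (n + 1) → Set V, FilteredEnds.IsEndFamily H Y.toSimpleGraph A' := by
      rw [← keyH, he]
      exact_mod_cast Nat.not_succ_le_self n
    refine le_antisymm ?_ ?_
    · by_contra hlt
      have h2 : ((2 : ℕ) : ℕ∞) ≤ Y'.filteredEnds K D := by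
        have := Order.add_one_le_of_lt (not_le.1 hlt)
        rwa [one_add_one_eq_two] at this
      obtain ⟨B, hB⟩ := (key 2).1 h2
      exact hf (hY.isCofiniteFree.finiteIndex hKH hV hA hmax (hB.almostInvariant 0)
        (hB.not_small 0) fun h => hB.not_small 1
          (h.mono fun v hv hv' => Set.disjoint_left.1 (hB.disjoint 0 1 (by decide)) hv' hv))
    · have : ((1 : ℕ) : ℕ∞) ≤ Y'.filteredEnds K D := by
        refine (key 1).2 ⟨fun _ => Set.univ, fun i j h => (h (Subsingleton.elim i j)).elim,
          fun _ => FilteredEnds.Small.mono (FilteredEnds.small_of_finite Set.finite_empty)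
            fun w hw => (hw.1 (Set.mem_univ w)).elim, fun _ h => hV (h.of_le hKH)⟩
      exact_mod_cast this
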